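/- Let $(A,[\cdot,\cdot],\rho)$ be a Lie algebroid of finite rank over a smooth manifold $M$, with differential $d$ on $\Omega^\bullet(A)=\Gamma(\bigwedge^\bullet A^*)$ and Lie derivative $\mathcal L$, and let $H\in\Gamma(\bigwedge^3A^*)$ with $dH=0$. Let $\pi\in\Gamma(\bigwedge^2A)$, $N\in\Gamma(A\otimes A^*)$, $\sigma\in\Gamma(\bigwedge^2A^*)$, put $\pi^\sharp\alpha=\pi(\alpha,\cdot)$, $\sigma^\flat X=\sigma(X,\cdot)$, and let $$J=\begin{pmatrix}N&\pi^\sharp\\ \sigma^\flat&-{}^tN\end{pmatrix}:A\oplus A^*\to A\oplus A^*.$$ Equip $A\oplus A^*$ with the pairing $\langle X+\alpha,Y+\beta\rangle=\beta(X)+\alpha(Y)$ and with the Dorfman bracket of the Courant algebroid $(A\oplus A^*,\mu+H)$, $$[X+\alpha,Y+\beta]=[X,Y]+\mathcal L_X\beta-i_Yd\alpha-H(X,Y,\cdot),$$ and assume that $J$ is an (integrable) c.p.s. structure: $\langle J\mathcal X,\mathcal Y\rangle+\langle\mathcal X,J\mathcal Y\rangle=0$, $J^2=\lambda\,\mathrm{id}$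 with $\lambda\in\{-1,0,1\}$, and $T_J(\mathcal X,\mathcal Y)=[J\mathcal X,J\mathcal Y]-J([J\mathcal X,\mathcal Y]+[\mathcal X,J\mathcal Y]-J[\mathcal X,\mathcal Y])=0$ for all $\mathcal X,\mathcal Y\in\Gamma(A\oplus A^*)$. Then $(\pi,N,\psi,H)$ with $\psi=-d\sigma$ is a Poisson quasi-Nijenhuis structure with background $H$ on $A$, that is: $N\circ\pi^\sharp=\pi^\sharp\circ{}^tN$, $d\psi=0$, $dH=0$, and 1. $\pi$ is a Poisson bivector, $[\pi,\pi]_{SN}=0$; 2. $C_{\pi,N}(\alpha,\beta)=2\,H(\pi^\sharp\alpha,\pi^\sharp\beta,\cdot)$ for all $\alpha,\beta\in\Gamma(A^*)$; 3. $T_N(X,Y)=-\pi^\sharp\big(H(NX,Y,\cdot)-H(NY,X,\cdot)+\psi(X,Y,\cdot)\big)$ for all $X,Y\in\Gamma(A)$; 4. $d_N\psi=d\mathcal H$, where $\mathcal H(X,Y,Z)=H(NX,NY,Z)+H(NY,NZ,X)+H(NZ,NX,Y)$. Here $[X,Y]_N=[NX,Y]+[X,NY]-N[X,Y]$, $T_N(X,Y)=[NX,NY]-N[X,Y]_N$,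 $d_N$ is the operator given by the Cartan formula for the bracket $[\cdot,\cdot]_N$ and the anchor $\rho\circ N$, $[\alpha,\beta]_\pi=\mathcal L_{\pi^\sharp\alpha}\beta-\mathcal L_{\pi^\sharp\beta}\alpha-d(\pi(\alpha,\beta))$, and $C_{\pi,N}=([\cdot,\cdot]_N)_\pi-([\cdot,\cdot]_\pi)_{{}^tN}$. -/

import Mathlib

open scoped Manifold ContDiff

noncomputable section

namespace Algebroid

/-! ### Tensor calculus on the module of sections

`R` plays the role of `C^∞(M)` and `Γ` that of the `C^∞(M)`-module `Γ(A)` of smooth sections of a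
vector bundle `A → M` of finite rank.  Tensor fields are `C^∞(M)`-multilinear maps:
`Γ(A*) = Module.Dual R Γ`, `Γ(⋀ᵏ A*) = Γ [⋀^Fin k]→ₗ[R] R`, `Γ(A ⊗ A*) = Module.End R Γ`. -/

section Sections

variable {R : Type*} [CommRing R] {Γ : Type*} [AddCommGroup Γ] [Module R Γ]

section Alternating

lemma two_add_left (σ : Γ [⋀^Fin 2]→ₗ[R] R) (x y z : Γ) :
    σ ![x + y, z] = σ ![x, z] + σ ![y, z] := AlternatingMap.map_vecCons_add σ ![z] x y

lemma two_smul_left (σ : Γ [⋀^Fin 2]→ₗ[R] R) (c : R) (x z : Γ) :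
    σ ![c • x, z] = c * σ ![x, z] := AlternatingMap.map_vecCons_smul σ ![z] c x

lemma two_swap (σ : Γ [⋀^Fin 2]→ₗ[R] R) (x y : Γ) : σ ![x, y] = -σ ![y, x] := by
  rw [← AlternatingMap.map_swap σ ![y, x] (show (0 : Fin 2) ≠ 1 by decide)]
  congr 1; ext i; fin_cases i <;> simp

lemma two_self (σ : Γ [⋀^Fin 2]→ₗ[R] R) (x : Γ) : σ ![x, x] = 0 :=
  σ.map_eq_zero_of_eq ![x, x] (show ![x, x] 0 = ![x, x] 1 from rfl) (by decide)

lemma three_add_left (σ : Γ [⋀^Fin 3]→ₗ[R] R) (x y z w : Γ) :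
    σ ![x + y, z, w] = σ ![x, z, w] + σ ![y, z, w] := AlternatingMap.map_vecCons_add σ ![z, w] x y

lemma three_smul_left (σ : Γ [⋀^Fin 3]→ₗ[R] R) (c : R) (x z w : Γ) :
    σ ![c • x, z, w] = c * σ ![x, z, w] := AlternatingMap.map_vecCons_smul σ ![z, w] c x

lemma three_swap (σ : Γ [⋀^Fin 3]→ₗ[R] R) (x y z : Γ) : σ ![x, y, z] = -σ ![y, x, z] := by
  rw [← AlternatingMap.map_swap σ ![y, x, z] (show (0 : Fin 3) ≠ 1 by decide)]
  congr 1; ext i; fin_cases i <;> simp [Equiv.swap_apply_of_ne_of_ne]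

lemma three_swap' (σ : Γ [⋀^Fin 3]→ₗ[R] R) (x y z : Γ) : σ ![x, y, z] = -σ ![x, z, y] := by
  rw [← AlternatingMap.map_swap σ ![x, z, y] (show (1 : Fin 3) ≠ 2 by decide)]
  congr 1; ext i; fin_cases i <;> simp [Equiv.swap_apply_of_ne_of_ne]

lemma three_self (σ : Γ [⋀^Fin 3]→ₗ[R] R) (x z : Γ) : σ ![x, x, z] = 0 :=
  σ.map_eq_zero_of_eq ![x, x, z] (show ![x, x, z] 0 = ![x, x, z] 1 from rfl) (by decide)

/-- A function of three variables that is linear in the first one and alternating, as an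
alternating map. -/
def alternating3 (f : Γ → Γ → Γ → R)
    (add : ∀ x x' y z, f (x + x') y z = f x y z + f x' y z)
    (smul : ∀ (c : R) x y z, f (c • x) y z = c * f x y z)
    (swap : ∀ x y z, f x y z = -f y x z) (swap' : ∀ x y z, f x y z = -f x z y)
    (self : ∀ x z, f x x z = 0) : Γ [⋀^Fin 3]→ₗ[R] R where
  toFun v := f (v 0) (v 1) (v 2)
  map_update_add' := by
    have n01 : (0 : Fin 3) ≠ 1 := by decide
    have n02 : (0 : Fin 3) ≠ 2 := by decide
    have n12 : (1 : Fin 3) ≠ 2 := by decide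
    intro _ v i x y
    have h1 : ∀ x y y' z, f x (y + y') z = f x y z + f x y' z := fun x y y' z => by
      rw [swap, add, swap y, swap y']; ring
    have h2 : ∀ x y z z', f x y (z + z') = f x y z + f x y z' := fun x y z z' => by
      rw [swap', h1, swap' x z, swap' x z']; ring
    fin_cases i <;> simp [Function.update_of_ne, n01, n02, n12, n01.symm, n02.symm, n12.symm,
      add, h1, h2]
  map_update_smul' := by
    have n01 : (0 : Fin 3) ≠ 1 := by decide
    have n02 : (0 : Fin 3) ≠ 2 := by decide
    have n12 : (1 : Fin 3) ≠ 2 := by decide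
    intro _ v i c x
    have h1 : ∀ (c : R) x y z, f x (c • y) z = c * f x y z := fun c x y z => by
      rw [swap, smul, swap y]; ring
    have h2 : ∀ (c : R) x y z, f x y (c • z) = c * f x y z := fun c x y z => by
      rw [swap', h1, swap' x z]; ring
    fin_cases i <;> simp [Function.update_of_ne, n01, n02, n12, n01.symm, n02.symm, n12.symm,
      smul, h1, h2]
  map_eq_zero_of_eq' := by
    have s1 : ∀ x y, f x y y = 0 := fun x y => by
      rw [swap x y y, swap' y x y, self]; simp
    have s2 : ∀ x y, f x y x = 0 := fun x y => by rw [swap', self]; simp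
    intro v i j h hij
    fin_cases i <;> fin_cases j <;> first | exact absurd rfl hij | skip
    all_goals simp only [Fin.zero_eta, Fin.mk_one, Fin.reduceFinMk] at h
    · rw [h, self]
    · rw [h, s2]
    · rw [← h, self]
    · rw [h, s1]
    · rw [← h, s2]
    · rw [← h, s1]

/-- `σ♭ X = σ(X, ·)`. -/
def flat (σ : Γ [⋀^Fin 2]→ₗ[R] R) : Γ →ₗ[R] Module.Dual R Γ :=
  LinearMap.mk₂ R (fun X Y => σ ![X, Y]) (two_add_left σ) (fun c X Y => two_smul_left σ c X Y)
    (fun X Y Z => by rw [two_swap, two_add_left, two_swap σ Y, two_swap σ Z]; ring)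
    (fun c X Y => by rw [two_swap, two_smul_left, two_swap σ Y, smul_eq_mul]; ring)

/-- The `1`-form `H(X, Y, ·)`. -/
def insert₂ (H : Γ [⋀^Fin 3]→ₗ[R] R) (X Y : Γ) : Module.Dual R Γ where
  toFun Z := H ![X, Y, Z]
  map_add' Z W := by
    rw [three_swap', three_swap, three_swap' H X Y Z, three_swap H X Z, three_swap' H X Y W,
      three_swap H X W, three_add_left]
    ring
  map_smul' c Z := by
    rw [three_swap', three_swap, three_swap' H X Y Z, three_swap H X Z, three_smul_left]
    simp

/-- The `3`-form `𝓗(X, Y, Z) = H(NX, NY, Z) + H(NY, NZ, X) + H(NZ, NX, Y)`. -/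
def cyclicForm (N : Module.End R Γ) (H : Γ [⋀^Fin 3]→ₗ[R] R) : Γ [⋀^Fin 3]→ₗ[R] R :=
  alternating3 (fun X Y Z => H ![N X, N Y, Z] + H ![N Y, N Z, X] + H ![N Z, N X, Y])
    (fun x x' y z => by
      simp only [map_add, three_add_left]
      rw [three_swap' H (N y) (N z), three_swap H (N y), three_add_left,
        three_swap H (N z) (N x + _), three_add_left, three_swap' H (N y) (N z) x,
        three_swap H (N y) x, three_swap H (N z) (N x), three_swap' H (N y) (N z) x',
        three_swap H (N y) x', three_swap H (N z) (N x')]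
      ring)
    (fun c x y z => by
      simp only [map_smul, three_smul_left]
      rw [three_swap' H (N y) (N z), three_swap H (N y), three_smul_left,
        three_swap H (N z) (c • N x), three_smul_left, three_swap' H (N y) (N z) x,
        three_swap H (N y) x, three_swap H (N z) (N x)]
      ring)
    (fun x y z => by
      rw [three_swap H (N x) (N y), three_swap H (N y) (N z), three_swap H (N z) (N x)]; ring)
    (fun x y z => by
      rw [three_swap H (N x) (N y), three_swap H (N y) (N z), three_swap H (N z) (N x)]; ring)
    (fun x z => by rw [three_self, three_swap H (N x) (N z)]; ring)

end Alternating

variable (R Γ) in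
/-- A bivector field `π ∈ Γ(⋀² A)`, given by the skew-symmetric map `π♯ : Γ(A*) → Γ(A)`,
`π♯ α = π(α, ·)`. -/
structure Bivector where
  sharp : Module.Dual R Γ →ₗ[R] Γ
  alternating : ∀ α : Module.Dual R Γ, α (sharp α) = 0

namespace Bivector

/-- `π(α, β) = ⟨β, π♯ α⟩`. -/
def eval (π : Bivector R Γ) (α β : Module.Dual R Γ) : R := β (π.sharp α)

lemma eval_swap (π : Bivector R Γ) (α β : Module.Dual R Γ) : π.eval α β = -π.eval β α := by
  have h := π.alternating (α + β)
  simp only [map_add, LinearMap.add_apply, π.alternating] at h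
  simp only [eval]
  linear_combination h

end Bivector

/-! ### Brackets with an anchor -/

variable [Algebra ℝ R]

variable (R Γ) in
/-- A skew-symmetric bracket on `Γ` with an anchor, satisfying the Leibniz rule but not necessarily
the Jacobi identity. -/
structure SkewAlgebroid where
  bracket : Γ → Γ → Γ
  anchor : Γ →ₗ[R] Derivation ℝ R R
  add_bracket : ∀ X Y Z, bracket (X + Y) Z = bracket X Z + bracket Y Z
  bracket_add : ∀ X Y Z, bracket X (Y + Z) = bracket X Y + bracket X Z
  bracket_self : ∀ X, bracket X X = 0
  leibniz : ∀ X (f : R) Y, bracket X (f • Y) = f • bracket X Y + anchor X f • Y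

namespace SkewAlgebroid

variable (L : SkewAlgebroid R Γ)

lemma bracket_swap (X Y : Γ) : L.bracket X Y = -L.bracket Y X := by
  have h := L.bracket_self (X + Y)
  simp only [L.add_bracket, L.bracket_add, L.bracket_self, zero_add, add_zero] at h
  exact eq_neg_of_add_eq_zero_left h

lemma smul_bracket (f : R) (X Y : Γ) :
    L.bracket (f • X) Y = f • L.bracket X Y - L.anchor Y f • X := by
  rw [L.bracket_swap, L.leibniz, L.bracket_swap Y X]
  simp only [smul_neg]; abel

/-- The `1`-form `df = (X ↦ ρ(X) f)`. -/
def dFun (f : R) : Module.Dual R Γ where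
  toFun X := L.anchor X f
  map_add' X Y := by simp
  map_smul' c X := by simp

/-- The `1`-form `i_X dα`, where `dα(X, Y) = ρ(X) α(Y) - ρ(Y) α(X) - α([X, Y])`. -/
def insertD (X : Γ) (α : Module.Dual R Γ) : Module.Dual R Γ where
  toFun Y := L.anchor X (α Y) - L.anchor Y (α X) - α (L.bracket X Y)
  map_add' Y Z := by simp [L.bracket_add]; ring
  map_smul' c Y := by simp [L.leibniz]; ring

/-- The Lie derivative of a `1`-form, `(𝓛_X α)(Y) = ρ(X) α(Y) - α([X, Y])`. -/
def lieDeriv (X : Γ) (α : Module.Dual R Γ) : Module.Dual R Γ where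
  toFun Y := L.anchor X (α Y) - α (L.bracket X Y)
  map_add' Y Z := by simp [L.bracket_add]; ring
  map_smul' c Y := by simp [L.leibniz]; ring

/-- The exterior derivative of a `2`-form. -/
def d₂ (σ : Γ [⋀^Fin 2]→ₗ[R] R) : Γ [⋀^Fin 3]→ₗ[R] R :=
  alternating3 (fun X Y Z =>
      L.anchor X (σ ![Y, Z]) - L.anchor Y (σ ![X, Z]) + L.anchor Z (σ ![X, Y])
        - σ ![L.bracket X Y, Z] + σ ![L.bracket X Z, Y] - σ ![L.bracket Y Z, X])
    (fun x x' y z => by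
      rw [two_swap σ (L.bracket y z), two_swap σ (L.bracket y z) x, two_swap σ (L.bracket y z) x']
      simp only [L.add_bracket, two_add_left, map_add, Derivation.add_apply]
      ring)
    (fun c x y z => by
      rw [two_swap σ (L.bracket y z), two_swap σ (L.bracket y z) x]
      simp only [L.smul_bracket, two_smul_left, map_smul, Derivation.smul_apply, sub_eq_add_neg,
        two_add_left, Derivation.leibniz, ← neg_smul, smul_eq_mul]
      ring)
    (fun x y z => by
      have h (u v : Γ) : σ ![-u, v] = -σ ![u, v] := by
        rw [← neg_one_smul R u, two_smul_left]; ring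
      rw [two_swap σ x y, L.bracket_swap x y, h, map_neg]; ring)
    (fun x y z => by
      have h (u v : Γ) : σ ![-u, v] = -σ ![u, v] := by
        rw [← neg_one_smul R u, two_smul_left]; ring
      rw [two_swap σ y z, L.bracket_swap y z, h, map_neg]; ring)
    (fun x z => by
      have h (v : Γ) : σ ![0, v] = 0 := by
        rw [← zero_smul R (0 : Γ), two_smul_left, zero_mul]
      rw [two_self, L.bracket_self, h, map_zero]; ring)

/-- The exterior derivative of a `3`-form, evaluated on four sections. -/
def d₃ (η : Γ [⋀^Fin 3]→ₗ[R] R) (W X Y Z : Γ) : R :=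
  L.anchor W (η ![X, Y, Z]) - L.anchor X (η ![W, Y, Z])
    + L.anchor Y (η ![W, X, Z]) - L.anchor Z (η ![W, X, Y])
    - η ![L.bracket W X, Y, Z] + η ![L.bracket W Y, X, Z] - η ![L.bracket W Z, X, Y]
    - η ![L.bracket X Y, W, Z] + η ![L.bracket X Z, W, Y] - η ![L.bracket Y Z, W, X]

/-- The deformed bracket `[X, Y]_N = [NX, Y] + [X, NY] - N[X, Y]` with anchor `ρ ∘ N`. -/
def deform (N : Module.End R Γ) : SkewAlgebroid R Γ where
  bracket X Y := L.bracket (N X) Y + L.bracket X (N Y) - N (L.bracket X Y)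
  anchor := L.anchor ∘ₗ N
  add_bracket X Y Z := by simp only [map_add, L.add_bracket]; abel
  bracket_add X Y Z := by simp only [map_add, L.bracket_add]; abel
  bracket_self X := by rw [L.bracket_swap (N X), L.bracket_self]; simp
  leibniz X f Y := by
    simp only [map_add, map_smul, L.leibniz, smul_add, smul_sub, LinearMap.comp_apply]; abel

/-- The bracket `[α, β]_π = 𝓛_{π♯α} β - 𝓛_{π♯β} α - d(π(α, β))` on `Γ(A*)` with anchor
`ρ ∘ π♯`. -/
def koszul (π : Bivector R Γ) : SkewAlgebroid R (Module.Dual R Γ) where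
  bracket α β :=
    L.lieDeriv (π.sharp α) β - L.lieDeriv (π.sharp β) α - L.dFun (π.eval α β)
  anchor := L.anchor ∘ₗ π.sharp
  add_bracket α β γ := by
    ext X
    simp [lieDeriv, dFun, Bivector.eval, L.add_bracket]; ring
  bracket_add α β γ := by
    ext X
    simp [lieDeriv, dFun, Bivector.eval, L.add_bracket]; ring
  bracket_self α := by
    ext X
    simp [lieDeriv, dFun, Bivector.eval, π.alternating]
  leibniz α f β := by
    ext X
    have h : α (π.sharp β) = -β (π.sharp α) := π.eval_swap β α
    simp [lieDeriv, dFun, Bivector.eval, L.smul_bracket, h]; ring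

/-- The Schouten–Nijenhuis bracket of two bivectors,
`[P, Q](α, β, γ) = ∑ (⟨𝓛_{P♯α} β, Q♯γ⟩ + ⟨𝓛_{Q♯α} β, P♯γ⟩)`, summed over the cyclic permutations of
`(α, β, γ)`. -/
def schouten (P Q : Bivector R Γ) (α β γ : Module.Dual R Γ) : R :=
  (L.lieDeriv (P.sharp α) β (Q.sharp γ) + L.lieDeriv (Q.sharp α) β (P.sharp γ))
    + (L.lieDeriv (P.sharp β) γ (Q.sharp α) + L.lieDeriv (Q.sharp β) γ (P.sharp α))
    + (L.lieDeriv (P.sharp γ) α (Q.sharp β) + L.lieDeriv (Q.sharp γ) α (P.sharp β))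

/-- `π` is a Poisson bivector: `[π, π] = 0`. -/
def IsPoisson (π : Bivector R Γ) : Prop := ∀ α β γ, L.schouten π π α β γ = 0

/-- The Nijenhuis torsion `T_N(X, Y) = [NX, NY] - N([NX, Y] + [X, NY] - N[X, Y])`. -/
def torsion (N : Module.End R Γ) (X Y : Γ) : Γ :=
  L.bracket (N X) (N Y) - N ((L.deform N).bracket X Y)

/-- `C_{π,N} = ([·,·]_N)_π - ([·,·]_π)_{ᵗN}`. -/
def concomitant (π : Bivector R Γ) (N : Module.End R Γ) (α β : Module.Dual R Γ) :
    Module.Dual R Γ :=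
  ((L.deform N).koszul π).bracket α β - ((L.koszul π).deform N.dualMap).bracket α β

/-- Poisson quasi-Nijenhuis structures `(π, N, ψ, H)` with background. With `i_{X∧Y} = i_X i_Y`,
i.e. `i_{X∧Y} η = -η(X, Y, ·)`, the conditions on the concomitant and the torsion read
`C_{π,N}(α, β) = -2 i_{π♯α∧π♯β} H` and
`T_N(X, Y) = π♯(i_{NX∧Y} H - i_{NY∧X} H + i_{X∧Y} ψ)`. -/
structure IsPoissonQuasiNijenhuis (π : Bivector R Γ) (N : Module.End R Γ)
    (ψ H : Γ [⋀^Fin 3]→ₗ[R] R) : Prop where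
  comm : N ∘ₗ π.sharp = π.sharp ∘ₗ N.dualMap
  closed : ∀ W X Y Z, L.d₃ ψ W X Y Z = 0
  closed_background : ∀ W X Y Z, L.d₃ H W X Y Z = 0
  poisson : L.IsPoisson π
  concomitant_eq : ∀ α β, L.concomitant π N α β = (2 : R) • insert₂ H (π.sharp α) (π.sharp β)
  torsion_eq : ∀ X Y, L.torsion N X Y =
    -π.sharp (insert₂ H (N X) Y - insert₂ H (N Y) X + insert₂ ψ X Y)
  d_eq : ∀ W X Y Z, (L.deform N).d₃ ψ W X Y Z = L.d₃ (cyclicForm N H) W X Y Z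

/-! ### The Courant algebroid `(A ⊕ A*, μ + H)` -/

/-- The Dorfman bracket on `Γ(A ⊕ A*)` with background `H`,
`[X + α, Y + β] = [X, Y] + 𝓛_X β - i_Y dα + i_X i_Y H`; this is the derived bracket
`{{X + α, μ + H}, Y + β}` of the big bracket. Note `i_X i_Y H = -H(X, Y, ·)`. -/
def dorfman (H : Γ [⋀^Fin 3]→ₗ[R] R) (u v : Γ × Module.Dual R Γ) : Γ × Module.Dual R Γ :=
  (L.bracket u.1 v.1, L.lieDeriv u.1 v.2 - L.insertD v.1 u.2 - insert₂ H u.1 v.1)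

/-- `T_J(u, v) = [Ju, Jv] - J([Ju, v] + [u, Jv] - J[u, v])` for the Dorfman bracket. -/
def courantTorsion (H : Γ [⋀^Fin 3]→ₗ[R] R) (J : Module.End R (Γ × Module.Dual R Γ))
    (u v : Γ × Module.Dual R Γ) : Γ × Module.Dual R Γ :=
  L.dorfman H (J u) (J v) - J (L.dorfman H (J u) v + L.dorfman H u (J v) - J (L.dorfman H u v))

end SkewAlgebroid

/-- `⟨X + α, Y + β⟩ = β(X) + α(Y)`. -/
def pairing (u v : Γ × Module.Dual R Γ) : R := v.2 u.1 + u.2 v.1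

/-- The endomorphism `X + α ↦ (NX + π♯α) + (σ♭X - ᵗNα)` of `A ⊕ A*`. -/
def matrixJ (π : Bivector R Γ) (N : Module.End R Γ) (σ : Γ [⋀^Fin 2]→ₗ[R] R) :
    Module.End R (Γ × Module.Dual R Γ) :=
  LinearMap.prod (N.coprod π.sharp) ((flat σ).coprod (-N.dualMap))

/-- `J` is an integrable complex (`lam = -1`), product (`lam = 1`) or subtangent (`lam = 0`)
structure on the Courant algebroid `(A ⊕ A*, μ + H)`. -/
structure SkewAlgebroid.IsCPS (L : SkewAlgebroid R Γ) (H : Γ [⋀^Fin 3]→ₗ[R] R)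
    (J : Module.End R (Γ × Module.Dual R Γ)) (lam : ℝ) : Prop where
  lam_mem : lam = -1 ∨ lam = 0 ∨ lam = 1
  orthogonal : ∀ u v, pairing (J u) v + pairing u (J v) = 0
  sq : ∀ u, J (J u) = algebraMap ℝ R lam • u
  integrable : ∀ u v, L.courantTorsion H J u v = 0

end Sections

/-! ### Lie algebroids over smooth manifolds -/

section Bundle

variable {E : Type*} [NormedAddCommGroup E] [NormedSpace ℝ E]
  {M : Type*} [TopologicalSpace M] [ChartedSpace E M]
  {F : Type*} [NormedAddCommGroup F] [NormedSpace ℝ F]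
  {V : M → Type*} [TopologicalSpace (Bundle.TotalSpace F V)] [∀ x, TopologicalSpace (V x)]
  [∀ x, AddCommGroup (V x)] [∀ x, Module ℝ (V x)] [FiberBundle F V] [VectorBundle ℝ F V]

/-- The smooth sections of a vector bundle form a module over the smooth functions. -/
instance sectionModule : Module C^∞⟮𝓘(ℝ, E), M; ℝ⟯ Cₛ^∞⟮𝓘(ℝ, E); F, V⟯ where
  smul f s := ⟨fun x => f x • s x, f.contMDiff.smul_section s.contMDiff⟩
  one_smul s := by ext x; exact one_smul ℝ (s x)
  mul_smul f g s := by ext x; exact mul_smul (f x) (g x) (s x)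
  smul_zero f := by ext x; exact smul_zero (f x)
  smul_add f s t := by ext x; exact smul_add (f x) (s x) (t x)
  add_smul f g s := by ext x; exact add_smul (f x) (g x) (s x)
  zero_smul s := by ext x; exact zero_smul ℝ (s x)

lemma section_smul_apply (f : C^∞⟮𝓘(ℝ, E), M; ℝ⟯) (s : Cₛ^∞⟮𝓘(ℝ, E); F, V⟯) (x : M) :
    (f • s) x = f x • s x := rfl

variable [IsManifold 𝓘(ℝ, E) ∞ M]

/-- A smooth vector field `v` acts on smooth functions as a derivation, `(v f)(x) = df_x(v_x)`. -/
def vectorFieldDerivation (v : Cₛ^∞⟮𝓘(ℝ, E); E, (TangentSpace 𝓘(ℝ, E) : M → Type _)⟯) :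
    Derivation ℝ C^∞⟮𝓘(ℝ, E), M; ℝ⟯ C^∞⟮𝓘(ℝ, E), M; ℝ⟯ :=
  Derivation.mk'
    { toFun := fun f => ⟨fun x => mvfderiv 𝓘(ℝ, E) f x (v x), by
        have h := (f.contMDiff.contMDiff_tangentMap (m := ∞) (by simp)).comp v.contMDiff
        exact (contMDiff_snd_tangentBundle_modelSpace ℝ 𝓘(ℝ, ℝ)).comp h⟩
      map_add' := fun f g => by
        ext x
        change mvfderiv 𝓘(ℝ, E) (⇑f + ⇑g) x (v x) = _
        rw [mvfderiv_add f.mdifferentiableAt g.mdifferentiableAt]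
        rfl
      map_smul' := fun c f => by
        ext x
        change mvfderiv 𝓘(ℝ, E) ((fun _ : M => c) • ⇑f) x (v x) = _
        rw [mvfderiv_smul mdifferentiableAt_const f.mdifferentiableAt, mvfderiv_const]
        simp
        rfl }
    (fun f g => by
      ext x
      change mvfderiv 𝓘(ℝ, E) (⇑f * ⇑g) x (v x) = _
      rw [mvfderiv_mul f.mdifferentiableAt g.mdifferentiableAt]
      rfl)

/-- A smooth bundle map `ρ : A → TM` over the identity, applied to a smooth section of `A`. -/
def anchorApply [ContMDiffVectorBundle ∞ F V 𝓘(ℝ, E)]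
    (ρ : Cₛ^∞⟮𝓘(ℝ, E); F →L[ℝ] E, fun x : M => V x →L[ℝ] TangentSpace 𝓘(ℝ, E) x⟯)
    (X : Cₛ^∞⟮𝓘(ℝ, E); F, V⟯) :
    Cₛ^∞⟮𝓘(ℝ, E); E, (TangentSpace 𝓘(ℝ, E) : M → Type _)⟯ :=
  ⟨fun x => ρ x (X x), ρ.contMDiff.clm_bundle_apply X.contMDiff⟩

/-- The action `f ↦ ρ(X) f` of sections on functions. -/
def anchorAction [ContMDiffVectorBundle ∞ F V 𝓘(ℝ, E)]
    (ρ : Cₛ^∞⟮𝓘(ℝ, E); F →L[ℝ] E, fun x : M => V x →L[ℝ] TangentSpace 𝓘(ℝ, E) x⟯) :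
    Cₛ^∞⟮𝓘(ℝ, E); F, V⟯ →ₗ[C^∞⟮𝓘(ℝ, E), M; ℝ⟯]
      Derivation ℝ C^∞⟮𝓘(ℝ, E), M; ℝ⟯ C^∞⟮𝓘(ℝ, E), M; ℝ⟯ where
  toFun X := vectorFieldDerivation (anchorApply ρ X)
  map_add' X Y := by
    ext f x
    change mvfderiv 𝓘(ℝ, E) f x (ρ x (X x + Y x)) =
      mvfderiv 𝓘(ℝ, E) f x (ρ x (X x)) + mvfderiv 𝓘(ℝ, E) f x (ρ x (Y x))
    rw [map_add, map_add]
  map_smul' c X := by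
    ext f x
    change mvfderiv 𝓘(ℝ, E) f x (ρ x (c x • X x)) = c x • mvfderiv 𝓘(ℝ, E) f x (ρ x (X x))
    rw [map_smul, map_smul]

variable (E F V) in
/-- A Lie algebroid structure on the smooth vector bundle `V → M`: a Lie bracket on the smooth
sections and a bundle map `ρ : V → TM` compatible with the brackets, such that
`[X, fY] = f[X, Y] + (ρ(X)f)Y`. -/
structure LieAlgebroid [ContMDiffVectorBundle ∞ F V 𝓘(ℝ, E)] where
  bracket : Cₛ^∞⟮𝓘(ℝ, E); F, V⟯ → Cₛ^∞⟮𝓘(ℝ, E); F, V⟯ → Cₛ^∞⟮𝓘(ℝ, E); F, V⟯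
  anchor : Cₛ^∞⟮𝓘(ℝ, E); F →L[ℝ] E, fun x : M => V x →L[ℝ] TangentSpace 𝓘(ℝ, E) x⟯
  add_bracket : ∀ X Y Z, bracket (X + Y) Z = bracket X Z + bracket Y Z
  bracket_add : ∀ X Y Z, bracket X (Y + Z) = bracket X Y + bracket X Z
  bracket_self : ∀ X, bracket X X = 0
  jacobi : ∀ X Y Z,
    bracket X (bracket Y Z) = bracket (bracket X Y) Z + bracket Y (bracket X Z)
  leibniz : ∀ X (f : C^∞⟮𝓘(ℝ, E), M; ℝ⟯) Y,
    bracket X (f • Y) = f • bracket X Y + anchorAction anchor X f • Y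
  anchor_bracket : ∀ X Y,
    anchorAction anchor (bracket X Y) = ⁅anchorAction anchor X, anchorAction anchor Y⁆

/-- The bracket and the anchor of a Lie algebroid, on the level of sections. -/
def LieAlgebroid.toSkewAlgebroid [ContMDiffVectorBundle ∞ F V 𝓘(ℝ, E)]
    (A : LieAlgebroid E F V) :
    SkewAlgebroid C^∞⟮𝓘(ℝ, E), M; ℝ⟯ Cₛ^∞⟮𝓘(ℝ, E); F, V⟯ where
  bracket := A.bracket
  anchor := anchorAction A.anchor
  add_bracket := A.add_bracket
  bracket_add := A.bracket_add
  bracket_self := A.bracket_self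
  leibniz := A.leibniz

end Bundle

end Algebroid

end

noncomputable section

namespace Algebroid

variable {R : Type*} [CommRing R] {Γ : Type*} [AddCommGroup Γ] [Module R Γ]

/-! Each required identity is one block of `J² = λ` or of `T_J = 0`, and evaluating `T_J` on two
1-forms and on two sections of `A` suffices. The blocks of `J² = λ` give `N π♯ = π♯ ᵗN`, the
symmetry of `N` with respect to `σ` (so that `σ_N = σ(N·, ·)` is a 2-form), and `σ♭ π♯ = λ - (ᵗN)²`.

On two 1-forms, the vector part of `T_J = 0` says that `π♯` intertwines `[·,·]_π` with the bracket
of `A`, which is `[π, π] = 0` (`IsCPS.isPoisson`). The form part is half of the concomitant identity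
(`IsCPS.concomitant_eq`).

On two sections, the vector part is the torsion identity (`IsCPS.torsion_eq`), and the form part is
`i_N dσ = dσ_N + 𝓗 + λH` (`IsCPS.d₂_insert`). Since `d_N = i_N d - d i_N` (`deform_d₃`), `d² = 0`
(`d₃_d₂`) and `dH = 0`, it follows that `d_N dσ = -d(i_N dσ) = -d𝓗`, which is condition 4 for `ψ =
-dσ`. -/

lemma two_add_right (σ : Γ [⋀^Fin 2]→ₗ[R] R) (x y z : Γ) :
    σ ![x, y + z] = σ ![x, y] + σ ![x, z] := (flat σ x).map_add y z

lemma two_sub_left (σ : Γ [⋀^Fin 2]→ₗ[R] R) (x y z : Γ) :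
    σ ![x - y, z] = σ ![x, z] - σ ![y, z] := by
  have h := two_add_left σ (x - y) y z
  rw [sub_add_cancel] at h
  rw [h, add_sub_cancel_right]

lemma three_neg_left (η : Γ [⋀^Fin 3]→ₗ[R] R) (x y z : Γ) :
    η ![-x, y, z] = -η ![x, y, z] := by
  rw [← neg_one_smul R x, three_smul_left, neg_one_mul]

lemma three_sub_left (η : Γ [⋀^Fin 3]→ₗ[R] R) (x y z w : Γ) :
    η ![x - y, z, w] = η ![x, z, w] - η ![y, z, w] := by
  rw [sub_eq_add_neg, three_add_left, three_neg_left, sub_eq_add_neg]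

lemma three_rotate (η : Γ [⋀^Fin 3]→ₗ[R] R) (x y z : Γ) : η ![x, y, z] = η ![y, z, x] := by
  rw [three_swap, three_swap' η y x, neg_neg]

lemma flat_apply (σ : Γ [⋀^Fin 2]→ₗ[R] R) (x y : Γ) : flat σ x y = σ ![x, y] := rfl

lemma insert₂_apply (H : Γ [⋀^Fin 3]→ₗ[R] R) (x y z : Γ) : insert₂ H x y z = H ![x, y, z] := rfl

lemma cyclicForm_apply (N : Module.End R Γ) (H : Γ [⋀^Fin 3]→ₗ[R] R) (x y z : Γ) :
    cyclicForm N H ![x, y, z] = H ![N x, N y, z] + H ![N y, N z, x] + H ![N z, N x, y] := rfl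

/-- The `2`-form `σ_N(X, Y) = σ(NX, Y)`, for `N` symmetric with respect to `σ`. -/
def composeForm [Invertible (2 : R)] (σ : Γ [⋀^Fin 2]→ₗ[R] R) (N : Module.End R Γ)
    (symm : ∀ X Y, σ ![N X, Y] = σ ![X, N Y]) : Γ [⋀^Fin 2]→ₗ[R] R where
  toFun v := σ ![N (v 0), v 1]
  map_update_add' v i x y := by
    fin_cases i <;> simp [two_add_left, two_add_right]
  map_update_smul' v i c x := by
    have h (u w : Γ) : σ ![u, c • w] = c * σ ![u, w] := (flat σ u).map_smul c w
    fin_cases i <;> simp [two_smul_left, h]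
  map_eq_zero_of_eq' v i j h hij := by
    -- Symmetry of `N` and skewness of `σ` only give `2σ(Nx, x) = 0`; this is where 2 has to be
    -- invertible.
    have key (x : Γ) : σ ![N x, x] = 0 := by
      have h1 : σ ![N x, x] = -σ ![N x, x] := (symm x x).trans (two_swap σ x (N x))
      have h2 : (2 : R) * σ ![N x, x] = 0 := by linear_combination h1
      rw [← invOf_mul_cancel_left (2 : R) (σ ![N x, x]), h2, mul_zero]
    fin_cases i <;> fin_cases j <;> first | exact absurd rfl hij | skip
    all_goals simp only [Fin.zero_eta, Fin.mk_one] at h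
    · rw [h, key]
    · rw [← h, key]

lemma composeForm_apply [Invertible (2 : R)] (σ : Γ [⋀^Fin 2]→ₗ[R] R) (N : Module.End R Γ)
    (symm : ∀ X Y, σ ![N X, Y] = σ ![X, N Y]) (x y : Γ) :
    composeForm σ N symm ![x, y] = σ ![N x, y] := rfl

lemma matrixJ_apply (π : Bivector R Γ) (N : Module.End R Γ) (σ : Γ [⋀^Fin 2]→ₗ[R] R)
    (X : Γ) (α : Module.Dual R Γ) :
    matrixJ π N σ (X, α) = (N X + π.sharp α, flat σ X - N.dualMap α) := by
  simp [matrixJ, sub_eq_add_neg]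

namespace SkewAlgebroid

variable [Algebra ℝ R] (L : SkewAlgebroid R Γ)

/-! ### Exterior calculus: `d² = 0` and the deformed differential -/

lemma d₂_apply (σ : Γ [⋀^Fin 2]→ₗ[R] R) (X Y Z : Γ) :
    L.d₂ σ ![X, Y, Z] =
      L.anchor X (σ ![Y, Z]) - L.anchor Y (σ ![X, Z]) + L.anchor Z (σ ![X, Y])
        - σ ![L.bracket X Y, Z] + σ ![L.bracket X Z, Y] - σ ![L.bracket Y Z, X] := rfl

/-- The square of the exterior derivative vanishes on `2`-forms. -/
lemma d₃_d₂
    (jacobi : ∀ X Y Z, L.bracket X (L.bracket Y Z) =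
      L.bracket (L.bracket X Y) Z + L.bracket Y (L.bracket X Z))
    (anchor_bracket : ∀ X Y, L.anchor (L.bracket X Y) = ⁅L.anchor X, L.anchor Y⁆)
    (σ : Γ [⋀^Fin 2]→ₗ[R] R) (W X Y Z : Γ) : L.d₃ (L.d₂ σ) W X Y Z = 0 := by
  -- Jacobi with all brackets nested to the left. It is used below once for each of the four triples
  -- from `W, X, Y, Z`, the remaining section being the other argument of `σ`.
  have jac (X Y Z T : Γ) : σ ![L.bracket (L.bracket X Y) Z, T] =
      σ ![L.bracket (L.bracket X Z) Y, T] - σ ![L.bracket (L.bracket Y Z) X, T] := by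
    rw [← two_sub_left]
    congr 2
    have h := jacobi X Y Z
    rw [L.bracket_swap X, L.bracket_swap Y (L.bracket X Z)] at h
    rw [← sub_eq_zero] at h ⊢
    rw [← neg_eq_zero, ← h]; abel
  simp only [d₃, d₂_apply, anchor_bracket, Derivation.commutator_apply, map_add, map_sub]
  rw [jac W X Y Z, jac W X Z Y, jac W Y Z X, jac X Y Z W,
    two_swap σ (L.bracket X Y) (L.bracket W Z), two_swap σ (L.bracket X Z) (L.bracket W Y),
    two_swap σ (L.bracket Y Z) (L.bracket W X)]
  ring

/-- `d_N = [i_N, d]` on `3`-forms, where `η = i_N ψ`. -/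
lemma deform_d₃ (N : Module.End R Γ) (ψ η : Γ [⋀^Fin 3]→ₗ[R] R)
    (hη : ∀ X Y Z, η ![X, Y, Z] = ψ ![N X, Y, Z] + ψ ![X, N Y, Z] + ψ ![X, Y, N Z])
    (W X Y Z : Γ) :
    (L.deform N).d₃ ψ W X Y Z = L.d₃ ψ (N W) X Y Z + L.d₃ ψ W (N X) Y Z + L.d₃ ψ W X (N Y) Z
      + L.d₃ ψ W X Y (N Z) - L.d₃ η W X Y Z := by
  -- The terms where `N` hits neither the anchor argument nor the bracket cancel between `i_N dψ`
  -- and `dη`. What remains assembles into `ρ ∘ N` and `[·,·]_N`, so Jacobi plays no role.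
  simp only [d₃, deform, hη, LinearMap.comp_apply, map_add, three_add_left, three_sub_left]
  ring

lemma d₃_add (η θ : Γ [⋀^Fin 3]→ₗ[R] R) (W X Y Z : Γ) :
    L.d₃ (η + θ) W X Y Z = L.d₃ η W X Y Z + L.d₃ θ W X Y Z := by
  simp only [d₃, AlternatingMap.add_apply, map_add]; ring

lemma d₃_neg (η : Γ [⋀^Fin 3]→ₗ[R] R) (W X Y Z : Γ) :
    L.d₃ (-η) W X Y Z = -L.d₃ η W X Y Z := by
  simp only [d₃, AlternatingMap.neg_apply, map_neg]; ring

/-- Derivations kill real constants, so no `dc ∧ η` term appears. -/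
lemma d₃_algebraMap_smul (c : ℝ) (η : Γ [⋀^Fin 3]→ₗ[R] R) (W X Y Z : Γ) :
    L.d₃ (algebraMap ℝ R c • η) W X Y Z = algebraMap ℝ R c * L.d₃ η W X Y Z := by
  simp only [d₃, AlternatingMap.smul_apply, smul_eq_mul, Derivation.leibniz,
    Derivation.map_algebraMap]
  ring

/-! ### The Dorfman bracket on 1-forms and the Koszul bracket -/

lemma lieDeriv_zero (X : Γ) : L.lieDeriv X 0 = 0 := by ext; simp [lieDeriv]

lemma insertD_zero (X : Γ) : L.insertD X 0 = 0 := by ext; simp [insertD]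

lemma zero_bracket (X : Γ) : L.bracket 0 X = 0 := by
  simpa using L.add_bracket 0 0 X

lemma bracket_zero (X : Γ) : L.bracket X 0 = 0 := by
  simpa using L.bracket_add X 0 0

lemma dorfman_form_left (H : Γ [⋀^Fin 3]→ₗ[R] R) (α : Module.Dual R Γ)
    (v : Γ × Module.Dual R Γ) : L.dorfman H (0, α) v = (0, -L.insertD v.1 α) := by
  have h (Z : Γ) : H ![0, v.1, Z] = 0 := by simpa using three_smul_left H 0 0 v.1 Z
  ext <;> simp [dorfman, L.zero_bracket, lieDeriv, insert₂_apply, h]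

lemma dorfman_form_right (H : Γ [⋀^Fin 3]→ₗ[R] R) (u : Γ × Module.Dual R Γ)
    (β : Module.Dual R Γ) : L.dorfman H u (0, β) = (0, L.lieDeriv u.1 β) := by
  have h (Z : Γ) : H ![u.1, 0, Z] = 0 := by
    rw [three_swap]; simpa using three_smul_left H 0 0 u.1 Z
  ext Z
  · simp [dorfman, L.bracket_zero]
  · simp [dorfman, insertD, L.zero_bracket, insert₂_apply, h]

lemma dorfman_forms (H : Γ [⋀^Fin 3]→ₗ[R] R) (α β : Module.Dual R Γ) :
    L.dorfman H (0, α) (0, β) = 0 := by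
  have h := L.dorfman_form_left H α (0, β)
  rw [h]; ext <;> simp [insertD, L.zero_bracket]

/-- By Cartan's formula `𝓛_Y α = i_Y dα + d(α(Y))`, and `α(π♯β) = -π(α, β)` cancels the exact terms.
In this form the bracket is visibly the sum of the Dorfman brackets `[Jα, β] + [α, Jβ]`. -/
lemma koszul_bracket_eq (π : Bivector R Γ) (α β : Module.Dual R Γ) :
    (L.koszul π).bracket α β = L.lieDeriv (π.sharp α) β - L.insertD (π.sharp β) α := by
  ext X
  have h : α (π.sharp β) = -β (π.sharp α) := π.eval_swap β α
  simp [koszul, lieDeriv, insertD, dFun, Bivector.eval, h]; ring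

/-- `𝓛_X (i_Y σ) - i_Y d(i_X σ) - i_{[X, Y]} σ = dσ(X, Y, ·)`. -/
lemma insert₂_d₂ (σ : Γ [⋀^Fin 2]→ₗ[R] R) (X Y : Γ) :
    insert₂ (L.d₂ σ) X Y =
      L.lieDeriv X (flat σ Y) - L.insertD Y (flat σ X) - flat σ (L.bracket X Y) := by
  ext Z
  simp only [insert₂_apply, d₂_apply, lieDeriv, insertD, flat_apply, LinearMap.sub_apply,
    LinearMap.coe_mk, AddHom.coe_mk]
  rw [two_swap σ Y (L.bracket X Z), two_swap σ X (L.bracket Y Z)]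
  ring

/-! ### Block components of `J² = λ` and `T_J = 0` -/

section CPS

variable {L} {H : Γ [⋀^Fin 3]→ₗ[R] R} {π : Bivector R Γ} {N : Module.End R Γ}
  {σ : Γ [⋀^Fin 2]→ₗ[R] R} {lam : ℝ}

/-- This is the upper right block of `J² = λ`; the next two lemmas are the lower left and lower
right blocks. -/
lemma IsCPS.sharp_comm (hJ : L.IsCPS H (matrixJ π N σ) lam) (α : Module.Dual R Γ) :
    N (π.sharp α) = π.sharp (N.dualMap α) := by
  have h := congrArg Prod.fst (hJ.sq (0, α))
  simpa [matrixJ_apply, sub_eq_zero, ← sub_eq_add_neg] using h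

lemma IsCPS.flat_symm (hJ : L.IsCPS H (matrixJ π N σ) lam) (X Y : Γ) :
    σ ![N X, Y] = σ ![X, N Y] := by
  have h := congrArg (fun u => u.2 Y) (hJ.sq (X, 0))
  simpa [matrixJ_apply, sub_eq_zero, flat] using h

lemma IsCPS.flat_sharp (hJ : L.IsCPS H (matrixJ π N σ) lam) (α : Module.Dual R Γ) (X : Γ) :
    σ ![π.sharp α, X] = algebraMap ℝ R lam * α X - α (N (N X)) := by
  have h := congrArg (fun u => u.2 X) (hJ.sq (0, α))
  simp [matrixJ_apply, flat, Algebra.smul_def] at h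
  linear_combination h

/-- Two 1-forms have zero Dorfman bracket, so the term `J²[α, β]` drops out, and `[Jα, β] + [α, Jβ]`
is the 1-form `[α, β]_π`. -/
lemma courantTorsion_forms (π : Bivector R Γ) (α β : Module.Dual R Γ) :
    L.courantTorsion H (matrixJ π N σ) (0, α) (0, β) =
      (L.bracket (π.sharp α) (π.sharp β) - π.sharp ((L.koszul π).bracket α β),
        L.lieDeriv (π.sharp α) (-N.dualMap β) - L.insertD (π.sharp β) (-N.dualMap α)
          - insert₂ H (π.sharp α) (π.sharp β) + N.dualMap ((L.koszul π).bracket α β)) := by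
  rw [courantTorsion, dorfman_forms, dorfman_form_left, dorfman_form_right, map_zero, sub_zero,
    Prod.mk_add_mk, add_zero, matrixJ_apply, matrixJ_apply, matrixJ_apply, koszul_bracket_eq]
  simp only [dorfman, map_zero, zero_add, zero_sub, Prod.mk_sub_mk, sub_neg_eq_add,
    ← sub_eq_add_neg]

/-- The vector part of `T_J(α, β) = 0`. -/
lemma IsCPS.bracket_sharp (hJ : L.IsCPS H (matrixJ π N σ) lam) (α β : Module.Dual R Γ) :
    L.bracket (π.sharp α) (π.sharp β) = π.sharp ((L.koszul π).bracket α β) := by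
  have h := congrArg Prod.fst (hJ.integrable (0, α) (0, β))
  rw [courantTorsion_forms] at h
  exact sub_eq_zero.mp h

/-- The form part of `T_J(α, β) = 0`. -/
lemma IsCPS.koszul_apply (hJ : L.IsCPS H (matrixJ π N σ) lam) (α β : Module.Dual R Γ) (X : Γ) :
    (L.koszul π).bracket α β (N X) = L.lieDeriv (π.sharp α) (N.dualMap β) X
      - L.insertD (π.sharp β) (N.dualMap α) X + H ![π.sharp α, π.sharp β, X] := by
  have h := congrArg (fun u => u.2 X) (hJ.integrable (0, α) (0, β))
  simp only [courantTorsion_forms, Prod.snd_zero, LinearMap.sub_apply, LinearMap.add_apply,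
    LinearMap.zero_apply, LinearMap.dualMap_apply, insert₂_apply] at h
  have h1 : L.lieDeriv (π.sharp α) (-N.dualMap β) X
      = -L.lieDeriv (π.sharp α) (N.dualMap β) X := by
    simp [lieDeriv]; ring
  have h2 : L.insertD (π.sharp β) (-N.dualMap α) X
      = -L.insertD (π.sharp β) (N.dualMap α) X := by
    simp [insertD]; ring
  rw [h1, h2] at h
  linear_combination h

/-- Pairing the morphism property of `π♯` with `γ` and moving every `π♯` by skewness turns it into
the cyclic sum of `⟨𝓛_{π♯α} β, π♯γ⟩`. -/
lemma IsCPS.isPoisson (hJ : L.IsCPS H (matrixJ π N σ) lam) : L.IsPoisson π := by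
  intro α β γ
  have h := congrArg γ (hJ.bracket_sharp α β)
  have hs : γ (π.sharp ((L.koszul π).bracket α β)) = -(L.koszul π).bracket α β (π.sharp γ) :=
    π.eval_swap _ _
  have h1 : β (π.sharp γ) = -γ (π.sharp β) := π.eval_swap _ _
  have h2 : γ (π.sharp α) = -α (π.sharp γ) := π.eval_swap _ _
  have h3 : α (π.sharp β) = -β (π.sharp α) := π.eval_swap _ _
  rw [hs] at h
  simp only [koszul, lieDeriv, dFun, Bivector.eval, LinearMap.sub_apply, LinearMap.coe_mk,
    AddHom.coe_mk] at h
  simp only [schouten, lieDeriv, LinearMap.coe_mk, AddHom.coe_mk]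
  rw [L.bracket_swap (π.sharp γ) (π.sharp β), L.bracket_swap (π.sharp β) (π.sharp α)]
  simp only [h1, h2, h3, map_neg] at h ⊢
  -- For `P = Q = π` each term of the Schouten bracket occurs twice.
  linear_combination 2 * h

/-- Once `N π♯ = π♯ ᵗN`, the concomitant equals `2(ᵗN[α, β]_π - 𝓛_{π♯α}(ᵗNβ) + i_{π♯β} d(ᵗNα))`, and
the form part of `T_J(α, β) = 0` evaluates the parenthesis as `H(π♯α, π♯β, ·)`. -/
lemma IsCPS.concomitant_eq (hJ : L.IsCPS H (matrixJ π N σ) lam) (α β : Module.Dual R Γ) :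
    L.concomitant π N α β = (2 : R) • insert₂ H (π.sharp α) (π.sharp β) := by
  ext X
  have h := hJ.koszul_apply α β X
  -- Commutation makes `N π♯` skew as well, which identifies the two ways of inserting `N` into
  -- `π(α, β)`.
  have h3 : α (N (π.sharp β)) = -β (N (π.sharp α)) := by
    rw [hJ.sharp_comm α]; exact π.eval_swap β (N.dualMap α)
  simp only [koszul, lieDeriv, dFun, insertD, Bivector.eval, LinearMap.sub_apply, LinearMap.coe_mk,
    AddHom.coe_mk, LinearMap.dualMap_apply] at h
  simp only [concomitant, deform, koszul, lieDeriv, dFun, Bivector.eval, LinearMap.sub_apply,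
    LinearMap.add_apply, LinearMap.comp_apply, LinearMap.coe_mk,
    AddHom.coe_mk, LinearMap.dualMap_apply, ← hJ.sharp_comm, map_add, map_sub,
    LinearMap.smul_apply, insert₂_apply, smul_eq_mul]
  simp only [h3, map_neg] at h ⊢
  linear_combination 2 * h

/-- The forms `σ♭X`, `σ♭Y` and `σ♭[X, Y]` combine to `dσ(X, Y, ·)` by `insert₂_d₂`, so the argument
of the outer `J` is `[X, Y]_N` plus terms in `H` and `dσ`. -/
lemma courantTorsion_vectors (π : Bivector R Γ) (X Y : Γ) :
    L.courantTorsion H (matrixJ π N σ) (X, 0) (Y, 0) =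
      (L.bracket (N X) (N Y)
          - (N (L.bracket (N X) Y + L.bracket X (N Y) - N (L.bracket X Y) + π.sharp (insert₂ H X Y))
            + π.sharp (insert₂ (L.d₂ σ) X Y - insert₂ H (N X) Y - insert₂ H X (N Y)
              - N.dualMap (insert₂ H X Y))),
        L.lieDeriv (N X) (flat σ Y) - L.insertD (N Y) (flat σ X) - insert₂ H (N X) (N Y)
          - (flat σ (L.bracket (N X) Y + L.bracket X (N Y) - N (L.bracket X Y)
              + π.sharp (insert₂ H X Y))
            - N.dualMap (insert₂ (L.d₂ σ) X Y - insert₂ H (N X) Y - insert₂ H X (N Y)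
              - N.dualMap (insert₂ H X Y)))) := by
  have hJ (X : Γ) : matrixJ π N σ (X, 0) = (N X, flat σ X) := by simp [matrixJ_apply]
  have key : L.dorfman H (N X, flat σ X) (Y, 0) + L.dorfman H (X, 0) (N Y, flat σ Y)
      - matrixJ π N σ (L.dorfman H (X, 0) (Y, 0)) =
      (L.bracket (N X) Y + L.bracket X (N Y) - N (L.bracket X Y) + π.sharp (insert₂ H X Y),
        insert₂ (L.d₂ σ) X Y - insert₂ H (N X) Y - insert₂ H X (N Y)
          - N.dualMap (insert₂ H X Y)) := by
    simp only [dorfman, matrixJ_apply, zero_sub, sub_zero, Prod.mk_add_mk, Prod.mk_sub_mk,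
      L.lieDeriv_zero, L.insertD_zero, map_neg, insert₂_d₂]
    congr 1 <;> abel
  rw [courantTorsion, hJ, hJ, key, matrixJ_apply]
  rfl

/-- In the vector part, `N π♯ H(X, Y, ·)` and `π♯ ᵗN H(X, Y, ·)` cancel by commutation. -/
lemma IsCPS.torsion_eq (hJ : L.IsCPS H (matrixJ π N σ) lam) (X Y : Γ) :
    L.torsion N X Y =
      -π.sharp (insert₂ H (N X) Y - insert₂ H (N Y) X + insert₂ (-L.d₂ σ) X Y) := by
  have h := congrArg Prod.fst (hJ.integrable (X, 0) (Y, 0))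
  rw [courantTorsion_vectors, Prod.fst_zero] at h
  have hN := hJ.sharp_comm (insert₂ H X Y)
  have hH : insert₂ H X (N Y) = -insert₂ H (N Y) X := by
    ext Z; exact three_swap H _ _ _
  have hd : insert₂ (-L.d₂ σ) X Y = -insert₂ (L.d₂ σ) X Y := rfl
  simp only [map_add, map_sub, map_neg, hH, hd, hN] at h ⊢
  rw [← sub_eq_zero, ← h, torsion, deform]
  simp only [map_add, map_sub]
  abel

/-- The form part of `T_J(X, Y) = 0`, which reads `i_N dσ = dσ_N + 𝓗 + λ H`. -/
lemma IsCPS.d₂_insert [Invertible (2 : R)] (hJ : L.IsCPS H (matrixJ π N σ) lam) (X Y Z : Γ) :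
    (L.d₂ (composeForm σ N hJ.flat_symm) + cyclicForm N H + algebraMap ℝ R lam • H) ![X, Y, Z] =
      L.d₂ σ ![N X, Y, Z] + L.d₂ σ ![X, N Y, Z] + L.d₂ σ ![X, Y, N Z] := by
  have h := congrArg (fun u => u.2 Z) (hJ.integrable (X, 0) (Y, 0))
  -- Here `σ♭ π♯ = λ - (ᵗN)²` is applied to `H(X, Y, ·)`: the `λ` part is the source of `λH`, and
  -- the `(ᵗN)²` part cancels the term with `ᵗN` applied twice to `H(X, Y, ·)`.
  simp only [courantTorsion_vectors, Prod.snd_zero, LinearMap.sub_apply,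
    LinearMap.zero_apply, LinearMap.dualMap_apply, insert₂_apply, flat_apply, two_add_left,
    two_sub_left, hJ.flat_sharp, lieDeriv, insertD, LinearMap.coe_mk, AddHom.coe_mk] at h
  have hH₁ : H ![N Y, N Z, X] = H ![X, N Y, N Z] := (three_rotate H _ _ _).symm
  have hH₂ : H ![N Z, N X, Y] = H ![N X, Y, N Z] := three_rotate H _ _ _
  simp only [AlternatingMap.add_apply, AlternatingMap.smul_apply, smul_eq_mul, d₂_apply,
    cyclicForm_apply, composeForm_apply, hH₁, hH₂] at h ⊢
  rw [two_swap σ Y (L.bracket (N X) Z), two_swap σ X (L.bracket (N Y) Z)] at h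
  -- All occurrences of `σ_N` are brought to the position of `N` that they have in `h`.
  rw [hJ.flat_symm (L.bracket X Z), hJ.flat_symm (L.bracket Y Z), hJ.flat_symm X Y,
    hJ.flat_symm X Z, hJ.flat_symm Y Z]
  linear_combination -h

end CPS

/-! ### Assembly of the quasi-Nijenhuis conditions -/

theorem IsCPS.isPoissonQuasiNijenhuis {L : SkewAlgebroid R Γ}
    (jacobi : ∀ X Y Z, L.bracket X (L.bracket Y Z) =
      L.bracket (L.bracket X Y) Z + L.bracket Y (L.bracket X Z))
    (anchor_bracket : ∀ X Y, L.anchor (L.bracket X Y) = ⁅L.anchor X, L.anchor Y⁆)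
    {H : Γ [⋀^Fin 3]→ₗ[R] R} (hH : ∀ W X Y Z, L.d₃ H W X Y Z = 0)
    {π : Bivector R Γ} {N : Module.End R Γ} {σ : Γ [⋀^Fin 2]→ₗ[R] R} {lam : ℝ}
    (hJ : L.IsCPS H (matrixJ π N σ) lam) :
    L.IsPoissonQuasiNijenhuis π N (-L.d₂ σ) H where
  comm := LinearMap.ext hJ.sharp_comm
  closed W X Y Z := by rw [d₃_neg, d₃_d₂ L jacobi anchor_bracket, neg_zero]
  closed_background := hH
  poisson := hJ.isPoisson
  concomitant_eq := hJ.concomitant_eq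
  torsion_eq := hJ.torsion_eq
  d_eq W X Y Z := by
    -- The inverse of 2 comes from `ℝ`; it makes `σ_N` available as an alternating form.
    let _ : Invertible (2 : R) :=
      (Invertible.map (algebraMap ℝ R) 2).copy 2 (map_ofNat _ 2).symm
    -- Take `η = i_N dσ = dσ_N + 𝓗 + λH`. After `d² = 0` and `dH = 0` only `-d𝓗` survives, and the
    -- sign in `ψ = -dσ` reverses it.
    rw [d₃_neg, L.deform_d₃ N _ _ hJ.d₂_insert]
    simp only [d₃_add, d₃_algebraMap_smul, d₃_d₂ L jacobi anchor_bracket, hH]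
    ring

end SkewAlgebroid

end Algebroid

end

theorem mainTheorem2
    {E : Type*} [NormedAddCommGroup E] [NormedSpace ℝ E] [FiniteDimensional ℝ E]
    {M : Type*} [TopologicalSpace M] [T2Space M] [SigmaCompactSpace M]
    [ChartedSpace E M] [IsManifold 𝓘(ℝ, E) ∞ M]
    {F : Type*} [NormedAddCommGroup F] [NormedSpace ℝ F] [FiniteDimensional ℝ F]
    {V : M → Type*} [TopologicalSpace (Bundle.TotalSpace F V)] [∀ x, TopologicalSpace (V x)]
    [∀ x, AddCommGroup (V x)] [∀ x, Module ℝ (V x)] [FiberBundle F V] [VectorBundle ℝ F V]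
    [ContMDiffVectorBundle ∞ F V 𝓘(ℝ, E)]
    (A : Algebroid.LieAlgebroid E F V)
    (π : Algebroid.Bivector C^∞⟮𝓘(ℝ, E), M; ℝ⟯ Cₛ^∞⟮𝓘(ℝ, E); F, V⟯)
    (N : Module.End C^∞⟮𝓘(ℝ, E), M; ℝ⟯ Cₛ^∞⟮𝓘(ℝ, E); F, V⟯)
    (σ : Cₛ^∞⟮𝓘(ℝ, E); F, V⟯ [⋀^Fin 2]→ₗ[C^∞⟮𝓘(ℝ, E), M; ℝ⟯] C^∞⟮𝓘(ℝ, E), M; ℝ⟯)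
    (H : Cₛ^∞⟮𝓘(ℝ, E); F, V⟯ [⋀^Fin 3]→ₗ[C^∞⟮𝓘(ℝ, E), M; ℝ⟯] C^∞⟮𝓘(ℝ, E), M; ℝ⟯)
    (hH : ∀ W X Y Z, A.toSkewAlgebroid.d₃ H W X Y Z = 0)
    (lam : ℝ)
    (hJ : A.toSkewAlgebroid.IsCPS H (Algebroid.matrixJ π N σ) lam) :
    A.toSkewAlgebroid.IsPoissonQuasiNijenhuis π N (-A.toSkewAlgebroid.d₂ σ) H := by
  exact hJ.isPoissonQuasiNijenhuis A.jacobi A.anchor_bracket hH
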